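/- All structures are finite, nonempty and relational, over finite vocabularies. A generalized quantifier $Q_{\mathcal K}$ is given by an isomorphism-closed class $\mathcal K$ of $\tau$-structures for some vocabulary $\tau$. In a structure $\mathbf A$ with assignment $\alpha$, the formula $Q_{\mathcal K}\,\bar y_1,\dots,\bar y_m\,(\psi_1,\dots,\psi_m)$ is true iff the $\tau$-structure with universe $A$ and relations $\{\bar b \mid (\mathbf A,\alpha[\bar b/\bar y_i])\models\psi_i\}$ belongs to $\mathcal K$. The arity of $Q_{\mathcal K}$ is the maximum arity of the symbols of $\tau$, and $\mathcal Q_r$ is the collection of all quantifiers of arity at most $r$. For a collection $\mathcal Q$ of quantifiers, $\mathcal L(\mathcal Q)=\bigcup_k\mathcal L^k(\mathcal Q)$, where $\mathcal L^k(\mathcal Q)$ is the extension by the quantifiers in $\mathcal Q$ of the infinitary logic with $k$ variables. We write $\mathcal L(\mathcal Q)\le\mathcal L(\mathcal Q')$ if every sentence of $\mathcal L(\mathcal Q)$ is equivalent, on all (finite) structures of its vocabulary, to a sentence of $\mathcal L(\mathcal Q')$. For $\ell\ge 3$, the partial near-unanimity function $n^\ell_A\colon A^\ell\to A$ has the value $a$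 if at least $\ell-1$ of its arguments equal $a$, and is undefined if there is no such $a$. For a structure $\mathbf B$, let $n^\ell(\mathbf B)$ be the structure with the same universe whose relations consist of all tuples obtained by applying $n^\ell$ columnwise to $\ell$ tuples of the corresponding relation of $\mathbf B$. The function $n^\ell$ is a partial polymorphism of $\mathbf B$ if every relation of $n^\ell(\mathbf B)$ is contained in that of $\mathbf B$. The quantifier $Q_{\mathcal K}$ is $\mathcal N^\ell$-closed if, for every $\mathbf B\in\mathcal K$, every structure $\mathbf A$ on the same universe whose relations are contained in those of $\mathbf B\cup n^\ell(\mathbf B)$ is also in $\mathcal K$. Let $\mathrm{CSP}(\mathbf B)$ be the class of all structures that map homomorphically to $\mathbf B$, and let $\mathcal Q^{\mathcal N^\ell_{\mathrm{CSP}}}_{r}$ be the collection of all $\mathcal N^\ell$-closed quantifiers of arity at most $r$ whose class is of the form $\mathrm{CSP}(\mathbf B)$. In the $k,r$-bijection game on $\mathbf A,\mathbf B$, positions are pairs $(\alpha,\beta)$ of partial assignments of $\{x_1,\dots,x_k\}$ in $\mathbf A$ and in $\mathbf B$ with equal domains, initially empty. In each round Duplicator chooses a bijection $f\colon A\to B$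 (and loses if there is none). Spoiler then chooses an $r$-tuple $\bar y$ of distinct variables and $\bar a\in A^r$, and the position becomes $(\alpha[\bar a/\bar y],\beta[f(\bar a)/\bar y])$. Spoiler wins if this does not induce a partial isomorphism from $\mathbf A$ to $\mathbf B$. Duplicator wins if Spoiler never wins. **Theorem.** For every $\ell\ge 3$, $$\mathcal L\bigl(\mathcal Q^{\mathcal N^\ell_{\mathrm{CSP}}}_{\ell+1}\bigr)\not\le\mathcal L(\mathcal Q_{\ell-1}).$$ Moreover, there is a structure $\mathbf B$ with universe $\mathbb Z_3$, all of whose relation symbols are $(\ell+1)$-ary, such that $n^\ell$ is a partial polymorphism of $\mathbf B$, the quantifier $Q_{\mathrm{CSP}(\mathbf B)}$ belongs to $\mathcal Q^{\mathcal N^\ell_{\mathrm{CSP}}}_{\ell+1}$, the class $\mathrm{CSP}(\mathbf B)$ is not definable by a sentence of $\mathcal L(\mathcal Q_{\ell-1})$, and for every $k\ge\ell-1$ there are structures $\mathbf A\in\mathrm{CSP}(\mathbf B)$ and $\tilde{\mathbf A}\notin\mathrm{CSP}(\mathbf B)$ such that Duplicator has a winning strategy in the $k,(\ell-1)$-bijection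 game on $\mathbf A$ and $\tilde{\mathbf A}$. -/

import Mathlib

open scoped FirstOrder

/-- A relational vocabulary with finitely many relation symbols. -/
structure FinRelational (τ : FirstOrder.Language.{0, 0}) : Prop where
  relational : τ.IsRelational
  finite_relations : Finite (Σ n, τ.Relations n)

/-- Finite (nonempty) structures over the vocabulary `τ`. -/
structure FinStr (τ : FirstOrder.Language.{0, 0}) where
  carrier : Type
  str : τ.Structure carrier
  finite : Finite carrier
  nonempty : Nonempty carrier

attribute [instance] FinStr.str FinStr.finite FinStr.nonempty

/-- The structure `S` on the finite nonempty set `A`, as an element of `FinStr τ`. -/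
def FinStr.of {τ : FirstOrder.Language.{0, 0}} (A : Type) [Finite A] [Nonempty A]
    (S : τ.Structure A) : FinStr τ :=
  ⟨A, S, inferInstance, inferInstance⟩

/-- There is a homomorphism from `A` to `B`. -/
def FinStr.MapsTo {τ : FirstOrder.Language.{0, 0}} (A B : FinStr τ) : Prop :=
  Nonempty (A.carrier →[τ] B.carrier)

/-- A generalized (Lindström) quantifier, given by an isomorphism-closed class of finite
structures over a finite relational vocabulary. -/
structure Quantifier where
  voc : FirstOrder.Language.{0, 0}
  finRelational : FinRelational voc
  cls : Set (FinStr voc)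
  iso_closed : ∀ A B : FinStr voc, Nonempty (A.carrier ≃[voc] B.carrier) → A ∈ cls → B ∈ cls

/-- All relation symbols of the vocabulary of `Q` have arity at most `r`. -/
def Quantifier.ArityLE (Q : Quantifier) (r : ℕ) : Prop :=
  ∀ n, Nonempty (Q.voc.Relations n) → n ≤ r

/-- The collection of all generalized quantifiers of arity at most `r`. -/
def quantifiersOfArity (r : ℕ) : Set Quantifier := {Q | Q.ArityLE r}

/-! ### The infinitary finite-variable logic with generalized quantifiers -/

/-- Formulas of the `k`-variable infinitary logic over the vocabulary `σ`, extended by the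
quantifiers in `𝒬`. The variables are the elements of `Fin k`. In the last rule, the tuple of
(distinct) variables `y n R` is bound in the formula `ψ n R`. -/
inductive Formula (σ : FirstOrder.Language.{0, 0}) (𝒬 : Set Quantifier) (k : ℕ) : Type 1
  | eq (i j : Fin k) : Formula σ 𝒬 k
  | rel (n : ℕ) (R : σ.Relations n) (x : Fin n → Fin k) : Formula σ 𝒬 k
  | neg (φ : Formula σ 𝒬 k) : Formula σ 𝒬 k
  | conj (ι : Type) (φ : ι → Formula σ 𝒬 k) : Formula σ 𝒬 k
  | disj (ι : Type) (φ : ι → Formula σ 𝒬 k) : Formula σ 𝒬 k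
  | ex (i : Fin k) (φ : Formula σ 𝒬 k) : Formula σ 𝒬 k
  | all (i : Fin k) (φ : Formula σ 𝒬 k) : Formula σ 𝒬 k
  | quant (Q : Quantifier) (hQ : Q ∈ 𝒬)
      (y : ∀ n, Q.voc.Relations n → (Fin n ↪ Fin k))
      (ψ : ∀ n, Q.voc.Relations n → Formula σ 𝒬 k) : Formula σ 𝒬 k

namespace Formula

variable {σ : FirstOrder.Language.{0, 0}} {𝒬 : Set Quantifier} {k : ℕ}

/-- The set of free variables. -/
def freeVars : Formula σ 𝒬 k → Set (Fin k)
  | eq i j => {i, j}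
  | rel _ _ x => Set.range x
  | neg φ => φ.freeVars
  | conj _ φ => ⋃ i, (φ i).freeVars
  | disj _ φ => ⋃ i, (φ i).freeVars
  | ex i φ => φ.freeVars \ {i}
  | all i φ => φ.freeVars \ {i}
  | quant _ _ y ψ => ⋃ n, ⋃ R, (ψ n R).freeVars \ Set.range (y n R)

/-- A sentence is a formula without free variables. -/
def IsSentence (φ : Formula σ 𝒬 k) : Prop := φ.freeVars = ∅

end Formula

open Classical in
/-- The assignment `α[b/y]`, for a tuple `y` of distinct variables. -/
noncomputable def updateTuple {A : Type} {k n : ℕ} (α : Fin k → A) (y : Fin n ↪ Fin k)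
    (b : Fin n → A) : Fin k → A :=
  fun v => if h : ∃ i, y i = v then b h.choose else α v

theorem updateTuple_apply {A : Type} {k n : ℕ} (α : Fin k → A) (y : Fin n ↪ Fin k)
    (b : Fin n → A) (i : Fin n) : updateTuple α y b (y i) = b i := by
  have h : ∃ j, y j = y i := ⟨i, rfl⟩
  have h2 : h.choose = i := y.injective h.choose_spec
  simp only [updateTuple, dif_pos h, h2]

theorem updateTuple_of_notMem {A : Type} {k n : ℕ} (α : Fin k → A) (y : Fin n ↪ Fin k)
    (b : Fin n → A) (v : Fin k) (hv : v ∉ Set.range y) : updateTuple α y b v = α v := by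
  have h : ¬ ∃ j, y j = v := hv
  simp only [updateTuple, dif_neg h]

/-- The structure on `A` over the relational vocabulary `τ` with the given relations. -/
@[reducible] def structureOfRel {τ : FirstOrder.Language.{0, 0}} (h : FinRelational τ) {A : Type}
    (r : ∀ n, τ.Relations n → (Fin n → A) → Prop) : τ.Structure A where
  funMap := fun {n} f _ => ((h.relational n).false f).elim
  RelMap := fun {n} R x => r n R x

/-- The truth of a formula in the structure `A` under an assignment. In the case of a quantifier
`Q`, the interpreted structure has the universe of `A`, and its relation `R` consists of the
tuples `b` for which `ψ n R` holds under `α[b/y n R]`. -/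
def Formula.Realize {σ : FirstOrder.Language.{0, 0}} {𝒬 : Set Quantifier} {k : ℕ} (A : FinStr σ) :
    Formula σ 𝒬 k → (Fin k → A.carrier) → Prop
  | eq i j, α => α i = α j
  | rel _ R x, α => FirstOrder.Language.Structure.RelMap R (fun m => α (x m))
  | neg φ, α => ¬ φ.Realize A α
  | conj _ φ, α => ∀ i, (φ i).Realize A α
  | disj _ φ, α => ∃ i, (φ i).Realize A α
  | ex i φ, α => ∃ a, φ.Realize A (Function.update α i a)
  | all i φ, α => ∀ a, φ.Realize A (Function.update α i a)
  | quant Q _ y ψ, α =>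
      (⟨A.carrier,
        structureOfRel Q.finRelational
          (fun n R b => (ψ n R).Realize A (updateTuple α (y n R) b)),
        A.finite, A.nonempty⟩ : FinStr Q.voc) ∈ Q.cls

/-- `A ⊨ φ`; used for sentences, whose truth does not depend on the assignment. -/
def FinStr.Models {σ : FirstOrder.Language.{0, 0}} {𝒬 : Set Quantifier} {k : ℕ} (A : FinStr σ)
    (φ : Formula σ 𝒬 k) : Prop :=
  ∀ α : Fin k → A.carrier, φ.Realize A α

/-- The class `K` of finite `σ`-structures is defined by a sentence of `ℒ(𝒬)`, where
`ℒ(𝒬)` is the union of the `k`-variable logics over all `k`. -/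
def DefinableIn {σ : FirstOrder.Language.{0, 0}} (𝒬 : Set Quantifier) (K : Set (FinStr σ)) : Prop :=
  ∃ (k : ℕ) (ψ : Formula σ 𝒬 k), ψ.IsSentence ∧ ∀ A : FinStr σ, A.Models ψ ↔ A ∈ K

/-- `ℒ(𝒬) ≤ ℒ(𝒬')`: every sentence of `ℒ(𝒬)`, over any finite relational vocabulary, is
equivalent (on finite structures) to a sentence of `ℒ(𝒬')`. -/
def LogicLE (𝒬 𝒬' : Set Quantifier) : Prop :=
  ∀ (σ : FirstOrder.Language.{0, 0}), FinRelational σ → ∀ (k : ℕ) (φ : Formula σ 𝒬 k), φ.IsSentence →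
    DefinableIn 𝒬' {A : FinStr σ | A.Models φ}

/-! ### Partial polymorphisms and CSP quantifiers -/

/-- The relation `p(R)`, obtained by applying the partial function `p` columnwise. -/
def applyColumns {A : Type} {ℓ n : ℕ} (p : (Fin ℓ → A) →. A) (R : Set (Fin n → A)) :
    Set (Fin n → A) :=
  {c | ∃ a : Fin ℓ → (Fin n → A), (∀ i, a i ∈ R) ∧ ∀ j, c j ∈ p (fun i => a i j)}

/-- `p` is a partial polymorphism of the structure on `A`. -/
def IsPartialPolymorphism (τ : FirstOrder.Language.{0, 0}) {A : Type} [τ.Structure A] {ℓ : ℕ}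
    (p : (Fin ℓ → A) →. A) : Prop :=
  ∀ (n : ℕ) (R : τ.Relations n),
    applyColumns p {x | FirstOrder.Language.Structure.RelMap R x} ⊆ {x | FirstOrder.Language.Structure.RelMap R x}

/-- `Q` is closed under the family `p` of partial functions: whenever `B` is in its class and
`S` is a structure on the universe of `B` with `S ≤ B ∪ p(B)`, also `S` is in the class. -/
def Quantifier.ClosedUnder (Q : Quantifier) {ℓ : ℕ} (p : ∀ A : Type, (Fin ℓ → A) →. A) : Prop :=
  ∀ B ∈ Q.cls, ∀ S : Q.voc.Structure B.carrier,
    (∀ (n : ℕ) (R : Q.voc.Relations n),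
      {x | S.RelMap R x} ⊆ {x | B.str.RelMap R x} ∪
        applyColumns (p B.carrier) {x | B.str.RelMap R x}) →
    (⟨B.carrier, S, B.finite, B.nonempty⟩ : FinStr Q.voc) ∈ Q.cls

/-- The `ℓ`-ary partial near-unanimity function: its value is `a` if at least `ℓ - 1` of the
arguments are equal to `a`, and it is undefined if there is no such `a`. -/
noncomputable def nearUnanimity (ℓ : ℕ) (A : Type) : (Fin ℓ → A) →. A :=
  fun x => ⟨∃ a, ℓ - 1 ≤ {i | x i = a}.ncard, fun h => h.choose⟩

theorem mem_nearUnanimity {ℓ : ℕ} (hℓ : 3 ≤ ℓ) {A : Type} (x : Fin ℓ → A) (a : A) :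
    a ∈ nearUnanimity ℓ A x ↔ ℓ - 1 ≤ {i | x i = a}.ncard := by
  have uniq : ∀ a b : A, ℓ - 1 ≤ {i | x i = a}.ncard → ℓ - 1 ≤ {i | x i = b}.ncard → a = b := by
    intro a b ha hb
    by_contra hab
    have hd : Disjoint {i | x i = a} {i | x i = b} := by
      rw [Set.disjoint_left]
      intro i hi hi'
      exact hab (hi.symm.trans hi')
    have h1 := Set.ncard_union_eq hd (Set.toFinite _) (Set.toFinite _)
    have h2 := Set.ncard_le_card ({i | x i = a} ∪ {i | x i = b})
    rw [Nat.card_eq_fintype_card, Fintype.card_fin] at h2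
    omega
  constructor
  · rintro ⟨h, rfl⟩
    exact h.choose_spec
  · intro h
    have h' : ∃ a, ℓ - 1 ≤ {i | x i = a}.ncard := ⟨a, h⟩
    exact ⟨h', uniq _ _ h'.choose_spec h⟩

/-- The CSP quantifier with template `B`; its class consists of all finite structures that map
homomorphically to `B`. -/
def cspQuantifier {τ : FirstOrder.Language.{0, 0}} (h : FinRelational τ) (B : FinStr τ) : Quantifier where
  voc := τ
  finRelational := h
  cls := {A | A.MapsTo B}
  iso_closed := by
    rintro A A' ⟨e⟩ ⟨f⟩
    exact ⟨f.comp e.symm.toHom⟩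

/-- `Q` is a CSP quantifier. -/
def Quantifier.IsCSP (Q : Quantifier) : Prop :=
  ∃ B : FinStr Q.voc, Q.cls = {A | A.MapsTo B}

/-- The collection of all CSP quantifiers of arity at most `r` that are closed under the `ℓ`-ary
partial near-unanimity functions. -/
def nearUnanimityCSPQuantifiers (ℓ r : ℕ) : Set Quantifier :=
  {Q | Q.IsCSP ∧ Q.ClosedUnder (nearUnanimity ℓ) ∧ Q.ArityLE r}

/-! ### The bijection game -/

section Game

variable {τ : FirstOrder.Language.{0, 0}}

/-- A position `(α, β)`: two partial assignments with the same domain, where the variable `v` is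
in the domain if the value at `v` is `some (α v, β v)`. -/
abbrev GamePosition (A B : FinStr τ) (k : ℕ) : Type := Fin k → Option (A.carrier × B.carrier)

/-- The map `α v ↦ β v` is a partial isomorphism from `A` to `B`. -/
def GamePosition.IsPartialIso {A B : FinStr τ} {k : ℕ} (p : GamePosition A B k) : Prop :=
  (∀ (v w : Fin k) (a a' : A.carrier) (b b' : B.carrier),
    p v = some (a, b) → p w = some (a', b') → (a = a' ↔ b = b')) ∧
  ∀ (n : ℕ) (R : τ.Relations n) (x : Fin n → Fin k) (a : Fin n → A.carrier)
    (b : Fin n → B.carrier), (∀ i, p (x i) = some (a i, b i)) →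
      (FirstOrder.Language.Structure.RelMap R a ↔ FirstOrder.Language.Structure.RelMap R b)

/-- A move of Spoiler: an `r`-tuple of distinct variables and an `r`-tuple of elements of `A`. -/
structure SpoilerMove (A : FinStr τ) (k r : ℕ) where
  vars : Fin r ↪ Fin k
  elems : Fin r → A.carrier

/-- The position reached after the given moves of Spoiler (most recent move first), if
Duplicator plays the bijection `s h` after the history `h`. -/
noncomputable def gamePosition {A B : FinStr τ} {k r : ℕ}
    (s : List (SpoilerMove A k r) → (A.carrier ≃ B.carrier)) :
    List (SpoilerMove A k r) → GamePosition A B k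
  | [] => fun _ => none
  | m :: h => updateTuple (gamePosition s h) m.vars
      (fun i => some (m.elems i, s h (m.elems i)))

/-- Duplicator has a winning strategy in the `k,r`-bijection game on `A` and `B`: a choice of
bijections, depending on the history, such that after every round the position is a partial
isomorphism. -/
def DuplicatorWins (k r : ℕ) (A B : FinStr τ) : Prop :=
  ∃ s : List (SpoilerMove A k r) → (A.carrier ≃ B.carrier),
    ∀ (h : List (SpoilerMove A k r)) (m : SpoilerMove A k r),
      (gamePosition s (m :: h)).IsPartialIso

end Game

/-!
The template is a ring `R` in which `2` is a unit, with the pairs of homogeneous linear equations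
`y₀ + y₁ + y₂ = 0` and `y₃ + ⋯ + y_{d+2} + (y₁ - y₂) = 0`, where `ℓ = d + 2`, together with all
translations. The function `n^ℓ` preserves the equations: each of the `d` columns `y₃, …, y_{d+2}`
of the `ℓ` rows has at most one deviating row, so that two rows are left which agree with the
result in all of these columns and therefore have the same value of `y₁ - y₂`. If they agree in
one of the entries `y₀, y₁, y₂`, they agree in all three; if not, one of them deviates in each of
these columns, and any third row agrees with the result there.

A system of such equations lives on the complete bipartite graph between two families of hubs. Each
of its edges, the links, is a variable which occurs at one hub of each family, so the system can
only be solved if the signed sum of its right-hand sides vanishes; in particular it is unsolvable if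
just one equation is in error. This error can be moved along any link, and also around the cycle of
any hub with at most one pebbled variable of its own. A round of the game pebbles at most `d + 1`
variables, too few to block both the hub of the vertex in error and all `d` ways out along its
links, while there are more blocks of hubs than pebbles. Hence Duplicator can always move the error
to a vertex with no pebbles around it, without changing the values of the pebbled variables. As
bijection games preserve the formulas of the logic, such structures show that the CSP quantifier is
not definable.
-/

theorem ncard_range_fin_le {α : Type*} {n : ℕ} (f : Fin n → α) : (Set.range f).ncard ≤ n := by
  simpa [Nat.card_coe_set_eq] using Finite.card_range_le f

/-! ### Games and definability -/

section Games

variable {σ : FirstOrder.Language.{0, 0}} {𝒬 : Set Quantifier} {k n r : ℕ}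

theorem updateTuple_cases {A : Type} (α : Fin k → A) (y : Fin n ↪ Fin k) (b : Fin n → A)
    (v : Fin k) :
    (∃ i, y i = v ∧ updateTuple α y b v = b i) ∨
      (v ∉ Set.range y ∧ updateTuple α y b v = α v) := by
  by_cases hv : v ∈ Set.range y
  · obtain ⟨i, rfl⟩ := hv
    exact .inl ⟨i, rfl, updateTuple_apply α y b i⟩
  · exact .inr ⟨hv, updateTuple_of_notMem α y b v hv⟩

theorem updateTuple_fin_one {A : Type} (α : Fin k → A) (y : Fin 1 ↪ Fin k) (b : Fin 1 → A) :
    updateTuple α y b = Function.update α (y 0) (b 0) := by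
  funext v
  rcases updateTuple_cases α y b v with ⟨i, rfl, h⟩ | ⟨hv, h⟩
  · rw [h, Subsingleton.elim i 0, Function.update_self]
  · rw [h, Function.update_of_ne fun hv' => hv ⟨0, hv'.symm⟩]

theorem Quantifier.mem_cls_iff_of_equiv (Q : Quantifier) {A B : FinStr Q.voc}
    (e : A.carrier ≃ B.carrier)
    (he : ∀ (n : ℕ) (R : Q.voc.Relations n) (a : Fin n → A.carrier),
      FirstOrder.Language.Structure.RelMap R (e ∘ a) ↔
        FirstOrder.Language.Structure.RelMap R a) :
    A ∈ Q.cls ↔ B ∈ Q.cls := by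
  let f : A.carrier ≃[Q.voc] B.carrier :=
    { e with
      map_fun' := fun {n} c _ => ((Q.finRelational.relational n).false c).elim
      map_rel' := fun {n} R a => he n R a }
  exact ⟨Q.iso_closed A B ⟨f⟩, Q.iso_closed B A ⟨f.symm⟩⟩

theorem Quantifier.exists_arityLE (Q : Quantifier) : ∃ r, Q.ArityLE r := by
  have := Q.finRelational.finite_relations
  obtain ⟨r, hr⟩ := (Set.finite_range fun R : Σ n, Q.voc.Relations n => R.1).bddAbove
  exact ⟨r, fun n ⟨R⟩ => hr ⟨⟨n, R⟩, rfl⟩⟩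

theorem definableIn_cls {Q : Quantifier} (hQ : Q ∈ 𝒬) : DefinableIn 𝒬 Q.cls := by
  obtain ⟨r, hr⟩ := Q.exists_arityLE
  let y (n : ℕ) (R : Q.voc.Relations n) : Fin n ↪ Fin r := Fin.castLEEmb (hr n ⟨R⟩)
  let φ : Formula Q.voc 𝒬 r := .quant Q hQ y fun n R => .rel n R (y n R)
  have realize_φ (A : FinStr Q.voc) (α : Fin r → A.carrier) : φ.Realize A α ↔ A ∈ Q.cls :=
    Q.mem_cls_iff_of_equiv (Equiv.refl A.carrier) fun n R b => by
      change _ ↔ A.str.RelMap R fun i => updateTuple α (y n R) b (y n R i)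
      simp only [updateTuple_apply]
      rfl
  refine ⟨r, φ, ?_, fun A => ?_⟩
  · simp [φ, Formula.IsSentence, Formula.freeVars]
  · simp only [FinStr.Models, realize_φ, forall_const]

theorem not_logicLE_of_not_definableIn {𝒬' : Set Quantifier} {Q : Quantifier} (hQ : Q ∈ 𝒬)
    (h : ¬ DefinableIn 𝒬' Q.cls) : ¬ LogicLE 𝒬 𝒬' := by
  intro hle
  obtain ⟨k, φ, hφ, hdef⟩ := definableIn_cls hQ
  have heq : {A : FinStr Q.voc | A.Models φ} = Q.cls := Set.ext hdef
  exact h (heq ▸ hle Q.voc Q.finRelational k φ hφ)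

variable {A B : FinStr σ}

theorem GamePosition.IsPartialIso.mono {p q : GamePosition A B k} (hq : q.IsPartialIso)
    (hpq : ∀ v ab, p v = some ab → q v = some ab) : p.IsPartialIso :=
  ⟨fun v w _ _ _ _ hv hw => hq.1 v w _ _ _ _ (hpq v _ hv) (hpq w _ hw),
    fun n R x _ _ hx => hq.2 n R x _ _ fun i => hpq (x i) _ (hx i)⟩

/-- In the position `p` of the game with `k + r` variables, each variable in `S` carries its values
under `α` and `β`. The variables of a formula are the first `k` ones; the other `r` are spare, so
that Spoiler can fill up a tuple of fewer than `r` variables without disturbing `α` and `β`. -/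
def GamePosition.Assigns (p : GamePosition A B (k + r)) (S : Set (Fin k))
    (α : Fin k → A.carrier) (β : Fin k → B.carrier) : Prop :=
  ∀ v ∈ S, p (Fin.castAdd r v) = some (α v, β v)

theorem exists_spoilerMove_extending (hn : n ≤ r) (y : Fin n ↪ Fin k) (b : Fin n → A.carrier) :
    ∃ m : SpoilerMove A (k + r) r,
      (∀ i, m.vars (Fin.castLE hn i) = Fin.castAdd r (y i) ∧ m.elems (Fin.castLE hn i) = b i) ∧
      ∀ v ∉ Set.range y, Fin.castAdd r v ∉ Set.range m.vars := by
  obtain ⟨t, rfl⟩ := Nat.exists_eq_add_of_le hn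
  let vars : Fin (n + t) ↪ Fin (k + (n + t)) := finSumFinEquiv.symm.toEmbedding.trans
    ((y.sumMap (Fin.natAddEmb n)).trans finSumFinEquiv.toEmbedding)
  refine ⟨⟨vars, Fin.append b fun _ => Classical.choice A.nonempty⟩,
    fun i => ⟨?_, Fin.append_left b (fun _ => Classical.choice A.nonempty) i⟩, ?_⟩
  · change vars (Fin.castAdd t i) = _
    simp [vars]
  · rintro v hv ⟨i, hi⟩
    obtain ⟨i | i, rfl⟩ := finSumFinEquiv.surjective i
    · exact hv ⟨i, by simpa [vars] using hi⟩
    · simp [vars, Fin.ext_iff] at hi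
      omega

theorem exists_spoilerMove_assigns (hn : n ≤ r) (y : Fin n ↪ Fin k) (b : Fin n → A.carrier) :
    ∃ m : SpoilerMove A (k + r) r, ∀ (s : List (SpoilerMove A (k + r) r) → (A.carrier ≃ B.carrier))
      (h : List (SpoilerMove A (k + r) r)) (S : Set (Fin k)) (α : Fin k → A.carrier)
      (β : Fin k → B.carrier), (gamePosition s h).Assigns (S \ Set.range y) α β →
      (gamePosition s (m :: h)).Assigns S (updateTuple α y b) (updateTuple β y (s h ∘ b)) := by
  obtain ⟨m, hm, hfresh⟩ := exists_spoilerMove_extending (r := r) hn y b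
  refine ⟨m, fun s h S α β hS v hv => ?_⟩
  by_cases hy : v ∈ Set.range y
  · obtain ⟨i, rfl⟩ := hy
    rw [← (hm i).1, gamePosition, updateTuple_apply, updateTuple_apply, updateTuple_apply,
      (hm i).2, Function.comp_apply]
  · rw [gamePosition, updateTuple_of_notMem _ _ _ _ (hfresh v hy),
      updateTuple_of_notMem _ _ _ _ hy, updateTuple_of_notMem _ _ _ _ hy, hS v ⟨hv, hy⟩]

theorem isPartialIso_gamePosition {s : List (SpoilerMove A (k + r) r) → (A.carrier ≃ B.carrier)}
    (hs : ∀ h m, (gamePosition s (m :: h)).IsPartialIso) :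
    ∀ h : List (SpoilerMove A (k + r) r), (gamePosition s h).IsPartialIso
  | m :: h => hs h m
  | [] => (hs [] ⟨Fin.natAddEmb k, fun _ => Classical.choice A.nonempty⟩).mono
      fun _ _ h => (Option.some_ne_none _ h.symm).elim

/-- Along every play in which Duplicator follows `s`, the truth value of `φ` is the same under the
two assignments of the current position. -/
def Formula.PreservedBy (φ : Formula σ 𝒬 k)
    (s : List (SpoilerMove A (k + r) r) → (A.carrier ≃ B.carrier)) : Prop :=
  ∀ (h : List (SpoilerMove A (k + r) r)) (α : Fin k → A.carrier) (β : Fin k → B.carrier),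
    (gamePosition s h).Assigns φ.freeVars α β → (φ.Realize A α ↔ φ.Realize B β)

theorem Formula.PreservedBy.realize_updateTuple {φ : Formula σ 𝒬 k}
    {s : List (SpoilerMove A (k + r) r) → (A.carrier ≃ B.carrier)} (hφ : φ.PreservedBy s)
    (hn : n ≤ r) (y : Fin n ↪ Fin k) {h : List (SpoilerMove A (k + r) r)}
    {α : Fin k → A.carrier} {β : Fin k → B.carrier}
    (hp : (gamePosition s h).Assigns (φ.freeVars \ Set.range y) α β) (b : Fin n → A.carrier) :
    φ.Realize A (updateTuple α y b) ↔ φ.Realize B (updateTuple β y (s h ∘ b)) := by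
  obtain ⟨m, hm⟩ := exists_spoilerMove_assigns (A := A) (B := B) hn y b
  exact hφ (m :: h) _ _ (hm s h _ α β hp)

theorem Formula.PreservedBy.realize_update {φ : Formula σ 𝒬 k}
    {s : List (SpoilerMove A (k + r) r) → (A.carrier ≃ B.carrier)} (hφ : φ.PreservedBy s)
    (hr : 1 ≤ r) {i : Fin k} {h : List (SpoilerMove A (k + r) r)}
    {α : Fin k → A.carrier} {β : Fin k → B.carrier}
    (hp : (gamePosition s h).Assigns (φ.freeVars \ {i}) α β) (a : A.carrier) :
    φ.Realize A (Function.update α i a) ↔ φ.Realize B (Function.update β i (s h a)) := by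
  let y : Fin 1 ↪ Fin k := ⟨fun _ => i, Function.injective_of_subsingleton _⟩
  have hy : Set.range y = {i} := Set.range_const
  have h_iff := hφ.realize_updateTuple hr y (by rwa [hy]) fun _ => a
  rwa [updateTuple_fin_one, updateTuple_fin_one] at h_iff

theorem Formula.preservedBy_of_isPartialIso (hr : 1 ≤ r) (h𝒬 : 𝒬 ⊆ quantifiersOfArity r)
    {s : List (SpoilerMove A (k + r) r) → (A.carrier ≃ B.carrier)}
    (hs : ∀ h m, (gamePosition s (m :: h)).IsPartialIso) (φ : Formula σ 𝒬 k) :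
    φ.PreservedBy s := by
  induction φ with
  | eq i j =>
    exact fun h α β hp => (isPartialIso_gamePosition hs h).1 _ _ _ _ _ _
      (hp i (Set.mem_insert i {j})) (hp j (Set.mem_insert_of_mem i rfl))
  | rel n R x =>
    exact fun h α β hp => (isPartialIso_gamePosition hs h).2 n R (Fin.castAdd r ∘ x) _ _
      fun i => hp (x i) ⟨i, rfl⟩
  | neg φ ih => exact fun h α β hp => not_congr (ih h α β hp)
  | conj ι φ ih =>
    exact fun h α β hp => forall_congr' fun i =>
      ih i h α β fun v hv => hp v (Set.mem_iUnion_of_mem i hv)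
  | disj ι φ ih =>
    exact fun h α β hp => exists_congr fun i =>
      ih i h α β fun v hv => hp v (Set.mem_iUnion_of_mem i hv)
  | ex i φ ih => exact fun h α β hp => (s h).exists_congr (ih.realize_update hr hp)
  | all i φ ih => exact fun h α β hp => (s h).forall_congr fun {a} => ih.realize_update hr hp a
  | quant Q hQ y ψ ih =>
    exact fun h α β hp => Q.mem_cls_iff_of_equiv (s h) fun n R b =>
      ((ih n R).realize_updateTuple (h𝒬 hQ n ⟨R⟩) (y n R)
        (fun v hv => hp v (Set.mem_iUnion_of_mem n (Set.mem_iUnion_of_mem R hv))) b).symm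

theorem not_definableIn_of_duplicatorWins (hr : 1 ≤ r) (h𝒬 : 𝒬 ⊆ quantifiersOfArity r)
    {K : Set (FinStr σ)}
    (hK : ∀ k, r ≤ k → ∃ A A' : FinStr σ, A ∈ K ∧ A' ∉ K ∧ DuplicatorWins k r A A') :
    ¬ DefinableIn 𝒬 K := by
  rintro ⟨k, ψ, hψ, hdef⟩
  obtain ⟨A, A', hA, hA', s, hs⟩ := hK (k + r) (Nat.le_add_left r k)
  refine hA' ((hdef A').1 fun β => ?_)
  let α : Fin k → A.carrier := fun _ => Classical.choice A.nonempty
  have hempty : (gamePosition s []).Assigns ψ.freeVars α β := fun v hv =>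
    absurd hv (Set.eq_empty_iff_forall_notMem.1 hψ v)
  exact (ψ.preservedBy_of_isPartialIso hr h𝒬 hs [] α β hempty).1 ((hdef A).2 hA α)

open Classical in
theorem duplicatorWins_of_invariant (I : GamePosition A B k → Prop) (h_empty : I fun _ => none)
    (h_iso : ∀ p, I p → p.IsPartialIso)
    (h_step : ∀ p, I p → ∃ f : A.carrier ≃ B.carrier, ∀ m : SpoilerMove A k r,
      I (updateTuple p m.vars fun i => some (m.elems i, f (m.elems i)))) :
    DuplicatorWins k r A B := by
  obtain ⟨f₀, -⟩ := h_step _ h_empty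
  let reply (p : GamePosition A B k) : A.carrier ≃ B.carrier :=
    if hp : I p then (h_step p hp).choose else f₀
  let play (h : List (SpoilerMove A k r)) : GamePosition A B k :=
    h.foldr (fun m p => updateTuple p m.vars fun i => some (m.elems i, reply p (m.elems i)))
      fun _ => none
  have gamePosition_eq (h) : gamePosition (fun h => reply (play h)) h = play h := by
    induction h with
    | nil => rfl
    | cons m h ih => rw [gamePosition, ih]; rfl
  have invariant_play (h) : I (play h) := by
    induction h with
    | nil => exact h_empty
    | cons m h ih =>
      have hreply : reply (play h) = (h_step _ ih).choose := dif_pos ih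
      have h_spec := (h_step _ ih).choose_spec m
      rwa [← hreply] at h_spec
  exact ⟨fun h => reply (play h), fun h m => h_iso _ (gamePosition_eq (m :: h) ▸ invariant_play _)⟩

/-- The elements of `A` which carry a pebble. -/
def GamePosition.pebbled (p : GamePosition A B k) : Set A.carrier :=
  {a | ∃ v b, p v = some (a, b)}

theorem GamePosition.ncard_pebbled_le (p : GamePosition A B k) : p.pebbled.ncard ≤ k := by
  have hsub : some '' p.pebbled ⊆ Set.range fun v => (p v).map Prod.fst := by
    rintro _ ⟨a, ⟨v, b, h⟩, rfl⟩
    exact ⟨v, by simp [h]⟩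
  rw [← Set.ncard_image_of_injective _ (Option.some_injective _)]
  exact (Set.ncard_le_ncard hsub (Set.finite_range _)).trans (ncard_range_fin_le _)

theorem duplicatorWins_of_bijections (I : Set A.carrier → (A.carrier ≃ B.carrier) → Prop)
    (h_empty : ∃ f, I ∅ f)
    (h_rel : ∀ X f, I X f → ∀ (n : ℕ) (R : σ.Relations n) (a : Fin n → A.carrier),
      (∀ i, a i ∈ X) → (FirstOrder.Language.Structure.RelMap R a ↔
        FirstOrder.Language.Structure.RelMap R (f ∘ a)))
    (h_step : ∀ X f, I X f → X.ncard ≤ k → ∃ f' : A.carrier ≃ B.carrier, Set.EqOn f f' X ∧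
      ∀ (e : Fin r → A.carrier), ∀ Y ⊆ X ∪ Set.range e, I Y f') :
    DuplicatorWins k r A B := by
  refine duplicatorWins_of_invariant
    (fun p => ∃ f, I p.pebbled f ∧ ∀ v a b, p v = some (a, b) → b = f a) ?_ ?_ ?_
  · obtain ⟨f, hf⟩ := h_empty
    exact ⟨f, by simpa [GamePosition.pebbled] using hf, by simp⟩
  · rintro p ⟨f, hI, hf⟩
    refine ⟨fun v w a a' b b' hv hw => ?_, fun n R x a b hx => ?_⟩
    · rw [hf v a b hv, hf w a' b' hw, f.injective.eq_iff]
    · obtain rfl : b = f ∘ a := funext fun i => hf _ _ _ (hx i)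
      exact h_rel _ f hI n R a fun i => ⟨x i, _, hx i⟩
  · rintro p ⟨f, hI, hf⟩
    obtain ⟨f', hff', hI'⟩ := h_step _ f hI p.ncard_pebbled_le
    have updated (m : SpoilerMove A k r) {v a b}
        (h : updateTuple p m.vars (fun i => some (m.elems i, f' (m.elems i))) v = some (a, b)) :
        p v = some (a, b) ∨ a ∈ Set.range m.elems ∧ b = f' a := by
      rcases updateTuple_cases p m.vars (fun i => some (m.elems i, f' (m.elems i))) v with
        ⟨i, -, hi⟩ | ⟨-, hv⟩
      · obtain ⟨rfl, rfl⟩ := Prod.mk.inj (Option.some.inj (hi.symm.trans h))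
        exact .inr ⟨⟨i, rfl⟩, rfl⟩
      · exact .inl (hv.symm.trans h)
    refine ⟨f', fun m => ⟨f', hI' m.elems _ ?_, fun v a b h => ?_⟩⟩
    · rintro a ⟨v, b, h⟩
      exact (updated m h).imp (fun h => ⟨v, b, h⟩) And.left
    · rcases updated m h with h | ⟨-, h⟩
      · rw [hf v a b h, hff' ⟨v, b, h⟩]
      · exact h

end Games

/-! ### Partial near-unanimity functions -/

section NearUnanimity

variable {τ : FirstOrder.Language.{0, 0}} {ℓ n : ℕ} {A B : Type}

theorem exists_forall_ne_eq_of_mem_nearUnanimity (hℓ : 3 ≤ ℓ) {x : Fin ℓ → A} {a : A}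
    (h : a ∈ nearUnanimity ℓ A x) : ∃ i₀, ∀ i ≠ i₀, x i = a := by
  have : Nonempty (Fin ℓ) := ⟨⟨0, by omega⟩⟩
  have h_card := Set.ncard_add_ncard_compl {i | x i = a}
  rw [mem_nearUnanimity hℓ] at h
  rw [Nat.card_eq_fintype_card, Fintype.card_fin] at h_card
  obtain ⟨i₀, hi₀⟩ := (Set.ncard_le_one_iff_subset_singleton (s := {i | x i = a}ᶜ)).1 (by omega)
  exact ⟨i₀, fun i hi => by_contra fun hx => hi (hi₀ hx)⟩

theorem map_mem_nearUnanimity (hℓ : 3 ≤ ℓ) (f : A → B) {x : Fin ℓ → A} {a : A}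
    (h : a ∈ nearUnanimity ℓ A x) : f a ∈ nearUnanimity ℓ B (f ∘ x) := by
  rw [mem_nearUnanimity hℓ] at h ⊢
  exact h.trans (Set.ncard_le_ncard (fun i hi => congrArg f hi) (Set.toFinite _))

theorem closedUnder_cspQuantifier (hτ : FinRelational τ) {p : ∀ A : Type, (Fin ℓ → A) →. A}
    (p_map : ∀ {A B : Type} (f : A → B) {x : Fin ℓ → A} {a : A}, a ∈ p A x → f a ∈ p B (f ∘ x))
    {B : FinStr τ} (hB : IsPartialPolymorphism τ (p B.carrier)) :
    (cspQuantifier hτ B).ClosedUnder p := by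
  rintro (A : FinStr τ) (⟨f⟩ : A.MapsTo B) S hS
  refine ⟨@FirstOrder.Language.Hom.mk τ A.carrier B.carrier S B.str f
    (fun {_} c _ => ((hτ.relational _).false c).elim) fun {n} R x hx => ?_⟩
  rcases hS n R hx with hx | ⟨a, ha, hxa⟩
  · exact f.map_rel' R x hx
  · exact hB n R ⟨fun i => f ∘ a i, fun i => f.map_rel' R (a i) (ha i), fun j => p_map f (hxa j)⟩

theorem cspQuantifier_mem_nearUnanimityCSPQuantifiers (hℓ : 3 ≤ ℓ) (hτ : FinRelational τ)
    {B : FinStr τ} (hB : IsPartialPolymorphism τ (nearUnanimity ℓ B.carrier)) {r : ℕ}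
    (hr : ∀ n, Nonempty (τ.Relations n) → n ≤ r) :
    cspQuantifier hτ B ∈ nearUnanimityCSPQuantifiers ℓ r :=
  ⟨⟨B, rfl⟩, closedUnder_cspQuantifier hτ (map_mem_nearUnanimity hℓ) hB, hr⟩

theorem exists_rows_of_mem_applyColumns (hℓ : 3 ≤ ℓ) {R : Set (Fin n → A)} {c : Fin n → A}
    (hc : c ∈ applyColumns (nearUnanimity ℓ A) R) :
    ∃ (a : Fin ℓ → Fin n → A) (r : Fin n → Fin ℓ), (∀ i, a i ∈ R) ∧
      ∀ j, ∀ i ≠ r j, a i j = c j := by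
  obtain ⟨a, ha, hc⟩ := hc
  choose r hr using fun j => exists_forall_ne_eq_of_mem_nearUnanimity hℓ (hc j)
  exact ⟨a, r, ha, hr⟩

theorem applyColumns_nearUnanimity_subset_of_forall_ne (hℓ : 3 ≤ ℓ) {R : Set (Fin n → A)}
    (hR : ∀ x ∈ R, ∀ y ∈ R, x ≠ y → ∀ j, x j ≠ y j) :
    applyColumns (nearUnanimity ℓ A) R ⊆ R := by
  intro c hc
  obtain ⟨a, r, ha, hr⟩ := exists_rows_of_mem_applyColumns hℓ hc
  by_cases h_eq : ∀ i i', a i = a i'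
  · obtain rfl : c = a ⟨0, by omega⟩ := funext fun j => by
      have : Nontrivial (Fin ℓ) := Fin.nontrivial_iff_two_le.2 (by omega)
      obtain ⟨i, hi⟩ := exists_ne (r j)
      rw [← hr j i hi, h_eq]
    exact ha _
  · push Not at h_eq
    obtain ⟨i₁, i₂, h_ne⟩ := h_eq
    obtain ⟨i₃, h₁, h₂⟩ := Fin.exists_ne_and_ne_of_two_lt i₁ i₂ hℓ
    have row_eq (j) : a i₃ j = c j := hr j i₃ fun h => hR _ (ha i₁) _ (ha i₂) h_ne j <|
      (hr j i₁ (h ▸ h₁.symm)).trans (hr j i₂ (h ▸ h₂.symm)).symm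
    exact funext row_eq ▸ ha i₃

end NearUnanimity

/-! ### The template -/

section Template

/-- The relation symbols of the template over the ring `R`, all of arity `d + 3`: one for a pair of
linear equations, and one for each translation of `R`. -/
inductive TemplateRel (R : Type) (d : ℕ) : ℕ → Type
  | lin : TemplateRel R d (d + 3)
  | translate (t : R) : TemplateRel R d (d + 3)

/-- The relational vocabulary of the template. -/
def templateVoc (R : Type) (d : ℕ) : FirstOrder.Language.{0, 0} :=
  ⟨fun _ => Empty, TemplateRel R d⟩

variable {R : Type} {d : ℕ}

theorem finRelational_templateVoc [Finite R] : FinRelational (templateVoc R d) where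
  relational _ := inferInstanceAs (IsEmpty Empty)
  finite_relations := by
    refine Finite.of_surjective (α := Option R)
      (fun o => ⟨d + 3, o.elim .lin .translate⟩ : Option R → Σ n, TemplateRel R d n) ?_
    rintro ⟨_, _ | t⟩
    exacts [⟨none, rfl⟩, ⟨some t, rfl⟩]

theorem eq_of_nonempty_templateVoc_relations {n : ℕ}
    (h : Nonempty ((templateVoc R d).Relations n)) : n = d + 3 := by
  obtain ⟨_ | _⟩ := h <;> rfl

variable [CommRing R]

/-- The solutions of the two equations at a vertex: the first three entries, in this order, stand
for its slope, its incoming chain and its outgoing chain, and the others for its `d` links. -/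
def linRel (d : ℕ) (c : R) : Set (Fin (d + 3) → R) :=
  {y | y 0 + y 1 + y 2 = 0 ∧ ∑ m : Fin d, y m.succ.succ.succ + (y 1 - y 2) = c}

/-- The tuples whose entries other than the first are all the translate by `t` of the first. -/
def translateRel (d : ℕ) (t : R) : Set (Fin (d + 3) → R) :=
  {y | ∀ i : Fin (d + 2), y i.succ = y 0 + t}

theorem zero_mem_linRel : (0 : Fin (d + 3) → R) ∈ linRel d 0 := by
  simp [linRel]

theorem add_mem_linRel {c c' : R} {y z : Fin (d + 3) → R} (hy : y ∈ linRel d c)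
    (hz : z ∈ linRel d c') : y + z ∈ linRel d (c + c') := by
  refine ⟨?_, ?_⟩
  · simp only [Pi.add_apply]
    linear_combination hy.1 + hz.1
  · simp only [Pi.add_apply, Finset.sum_add_distrib]
    linear_combination hy.2 + hz.2

theorem neg_mem_linRel {c : R} {y : Fin (d + 3) → R} (hy : y ∈ linRel d c) :
    -y ∈ linRel d (-c) := by
  refine ⟨?_, ?_⟩
  · simp only [Pi.neg_apply]
    linear_combination -hy.1
  · simp only [Pi.neg_apply, Finset.sum_neg_distrib]
    linear_combination -hy.2

theorem add_mem_linRel_iff {c c' : R} {y z : Fin (d + 3) → R} (hz : z ∈ linRel d c') :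
    y + z ∈ linRel d (c + c') ↔ y ∈ linRel d c :=
  ⟨fun h => by simpa using add_mem_linRel h (neg_mem_linRel hz), fun h => add_mem_linRel h hz⟩

theorem exists_mem_linRel (d : ℕ) (c : R) : ∃ y, y ∈ linRel d c :=
  ⟨Matrix.vecCons (-c) (Matrix.vecCons c 0), by simp [linRel]⟩

theorem applyColumns_translateRel (hd : 1 ≤ d) (t : R) :
    applyColumns (nearUnanimity (d + 2) R) (translateRel d t) ⊆ translateRel d t := by
  refine applyColumns_nearUnanimity_subset_of_forall_ne (by omega) fun x hx y hy h_ne j h_eq => ?_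
  have h_zero : x 0 = y 0 := by
    induction j using Fin.cases with
    | zero => exact h_eq
    | succ i => simpa only [hx i, hy i, add_left_inj] using h_eq
  exact h_ne (funext fun j => Fin.cases h_zero (fun i => by rw [hx i, hy i, h_zero]) j)

theorem head_eq_of_entry_eq (h2 : IsUnit (2 : R)) {x y : Fin 3 → R} (hx : x 0 + x 1 + x 2 = 0)
    (hy : y 0 + y 1 + y 2 = 0) (h_sub : x 1 - x 2 = y 1 - y 2) {j : Fin 3} (hj : x j = y j) :
    x = y := by
  have h₁ : x 1 = y 1 := by
    fin_cases j
    · refine h2.mul_left_cancel ?_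
      simp only [Fin.zero_eta] at hj
      linear_combination hx - hy + h_sub - hj
    · exact hj
    · simp only [Fin.reduceFinMk] at hj
      linear_combination h_sub + hj
  have h₂ : x 2 = y 2 := by linear_combination h₁ - h_sub
  have h₀ : x 0 = y 0 := by linear_combination hx - hy - h₁ - h₂
  funext j
  fin_cases j
  exacts [h₀, h₁, h₂]

theorem sub_eq_of_forall_eq_or_eq {x y c : Fin 3 → R} (hx : x 0 + x 1 + x 2 = 0)
    (hy : y 0 + y 1 + y 2 = 0) (h_sub : x 1 - x 2 = y 1 - y 2) (hc : c 0 + c 1 + c 2 = 0)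
    (h : ∀ j, c j = x j ∨ c j = y j) : c 1 - c 2 = x 1 - x 2 := by
  rcases h 0 with h₀ | h₀ <;> rcases h 1 with h₁ | h₁ <;> rcases h 2 with h₂ | h₂ <;> grind

theorem exists_ne_notMem_range (f : Fin d → Fin (d + 2)) :
    ∃ i ∉ Set.range f, ∃ j ∉ Set.range f, i ≠ j := by
  have h_card := Set.ncard_add_ncard_compl (Set.range f)
  have h_range := ncard_range_fin_le f
  rw [Nat.card_eq_fintype_card, Fintype.card_fin] at h_card
  exact (Set.one_lt_ncard (s := (Set.range f)ᶜ)).1 (by omega)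

theorem applyColumns_linRel (h2 : IsUnit (2 : R)) (hd : 1 ≤ d) (c : R) :
    applyColumns (nearUnanimity (d + 2) R) (linRel d c) ⊆ linRel d c := by
  intro y hy
  obtain ⟨a, r, ha, hr⟩ := exists_rows_of_mem_applyColumns (by omega) hy
  obtain ⟨i₁, hi₁, i₂, hi₂, h_ne⟩ :=
    exists_ne_notMem_range fun m : Fin d => r m.succ.succ.succ
  have sub_eq {i} (hi : i ∉ Set.range fun m : Fin d => r m.succ.succ.succ) :
      a i 1 - a i 2 = c - ∑ m : Fin d, y m.succ.succ.succ := by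
    rw [← (ha i).2, Finset.sum_congr rfl fun m _ => hr _ i fun h => hi ⟨m, h.symm⟩]
    ring
  let e : Fin 3 → Fin (d + 3) := ![0, 1, 2]
  have eq_or_eq (j : Fin 3) : y (e j) = a i₁ (e j) ∨ y (e j) = a i₂ (e j) := by
    by_cases h : i₁ = r (e j)
    · exact .inr (hr _ i₂ (h ▸ h_ne.symm)).symm
    · exact .inl (hr _ i₁ h).symm
  have sum_eq_zero : y 0 + y 1 + y 2 = 0 := by
    by_cases h : ∃ j, a i₁ (e j) = a i₂ (e j)
    · obtain ⟨j, hj⟩ := h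
      have head_eq : a i₁ ∘ e = a i₂ ∘ e :=
        head_eq_of_entry_eq h2 (ha i₁).1 (ha i₂).1 ((sub_eq hi₁).trans (sub_eq hi₂).symm) hj
      have y_eq (j) : y (e j) = a i₁ (e j) :=
        (eq_or_eq j).elim id fun h => h.trans (congrFun head_eq j).symm
      exact y_eq 0 ▸ y_eq 1 ▸ y_eq 2 ▸ (ha i₁).1
    · obtain ⟨i₃, h₁, h₂⟩ := Fin.exists_ne_and_ne_of_two_lt i₁ i₂ (by omega)
      have y_eq (j) : y (e j) = a i₃ (e j) := (hr _ i₃ fun h₃ => h ⟨j,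
        (hr _ i₁ (h₃ ▸ h₁.symm)).trans (hr _ i₂ (h₃ ▸ h₂.symm)).symm⟩).symm
      exact y_eq 0 ▸ y_eq 1 ▸ y_eq 2 ▸ (ha i₃).1
  refine ⟨sum_eq_zero, ?_⟩
  have y_sub : y 1 - y 2 = a i₁ 1 - a i₁ 2 :=
    sub_eq_of_forall_eq_or_eq (c := y ∘ e) (ha i₁).1 (ha i₂).1
      ((sub_eq hi₁).trans (sub_eq hi₂).symm) sum_eq_zero eq_or_eq
  rw [y_sub, sub_eq hi₁, add_sub_cancel]

/-- The template: the ring `R` with the homogeneous linear equations and with all translations. -/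
@[reducible] def templateStructure (R : Type) [CommRing R] [Finite R] (d : ℕ) :
    (templateVoc R d).Structure R :=
  structureOfRel finRelational_templateVoc fun _ S => match S with
    | .lin => fun y => y ∈ linRel d 0
    | .translate t => fun y => y ∈ translateRel d t

/-- The template as a finite structure. -/
@[reducible] def template (R : Type) [CommRing R] [Finite R] (d : ℕ) : FinStr (templateVoc R d) :=
  FinStr.of R (templateStructure R d)

theorem isPartialPolymorphism_template [Finite R] (h2 : IsUnit (2 : R)) (hd : 1 ≤ d) :
    @IsPartialPolymorphism (templateVoc R d) R (templateStructure R d) (d + 2)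
      (nearUnanimity (d + 2) R) := by
  rintro _ (_ | t)
  exacts [applyColumns_linRel h2 hd 0, applyColumns_translateRel hd t]

end Template

/-! ### The system of equations -/

section System

/-- The hubs of one of the two families, in `N` blocks of `d` hubs. The two families form a complete
bipartite graph, whose edges are the links. -/
abbrev Hub (d N : ℕ) : Type := ZMod N × Fin d

/-- The vertices. The large degree of a hub is distributed over a cycle of vertices: `(s, g, j)` is
the vertex of the hub `g` in the family `s` whose links lead to the `j`-th block of hubs in the
other family. -/
abbrev Vertex (d N : ℕ) : Type := Bool × Hub d N × ZMod N

/-- The variables of the system: the links between the hubs, the edges of the cycles, each given by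
its initial vertex, and one further variable for each vertex. -/
inductive Var (d N : ℕ) : Type
  | link (g h : Hub d N) : Var d N
  | chain (v : Vertex d N) : Var d N
  | slope (v : Vertex d N) : Var d N

variable {R : Type} [CommRing R] {d N : ℕ}

instance [NeZero N] : Finite (Var d N) :=
  Finite.of_surjective (α := (Hub d N × Hub d N) ⊕ Vertex d N ⊕ Vertex d N)
    (Sum.elim (fun e => .link e.1 e.2) (Sum.elim .chain .slope)) <| by
      rintro (⟨g, h⟩ | v | v)
      exacts [⟨.inl (g, h), rfl⟩, ⟨.inr (.inl v), rfl⟩, ⟨.inr (.inr v), rfl⟩]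

instance [NeZero d] : Nonempty (Var d N) := ⟨.link 0 0⟩

/-- The successor of a vertex on the cycle of its hub. -/
def Vertex.next (v : Vertex d N) : Vertex d N := (v.1, v.2.1, v.2.2 + 1)

/-- The links at a vertex. -/
def Vertex.links : Vertex d N → Fin d → Var d N
  | (false, g, j), m => .link g (j, m)
  | (true, h, i), m => .link (i, m) h

/-- The variables in the equations at a vertex, in the order of `linRel`. -/
def Vertex.scope (v : Vertex d N) : Fin (d + 3) → Var d N :=
  Matrix.vecCons (.slope v) (Matrix.vecCons (.chain v) (Matrix.vecCons (.chain v.next) v.links))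

/-- The assignment `σ` solves the system whose right-hand side at the vertex `v` is `c v`. -/
def Solves (σ : Var d N → R) (c : Vertex d N → R) : Prop :=
  ∀ v : Vertex d N, σ ∘ v.scope ∈ linRel d (c v)

theorem solves_iff {σ : Var d N → R} {c : Vertex d N → R} :
    Solves σ c ↔ ∀ v : Vertex d N, σ (.slope v) + σ (.chain v) + σ (.chain v.next) = 0 ∧
      ∑ m, σ (v.links m) + (σ (.chain v) - σ (.chain v.next)) = c v :=
  Iff.rfl

theorem solves_zero : Solves (0 : Var d N → R) 0 := fun _ => zero_mem_linRel

theorem Solves.add {σ σ' : Var d N → R} {c c' : Vertex d N → R} (h : Solves σ c)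
    (h' : Solves σ' c') : Solves (σ + σ') (c + c') :=
  fun v => add_mem_linRel (h v) (h' v)

theorem Solves.neg {σ : Var d N → R} {c : Vertex d N → R} (h : Solves σ c) : Solves (-σ) (-c) :=
  fun v => neg_mem_linRel (h v)

/-- The sign of a family of hubs, by which its equations are multiplied so that the two occurrences
of a link cancel. -/
def sign : Bool → R
  | false => 1
  | true => -1

theorem Solves.sum_family_eq_sum_link [NeZero N] {σ : Var d N → R} {c : Vertex d N → R}
    (h : Solves σ c) (s : Bool) : ∑ g, ∑ j, c (s, g, j) = ∑ g, ∑ g', σ (.link g g') := by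
  have sum_chain (g : Hub d N) :
      ∑ j, (σ (.chain (s, g, j)) - σ (.chain (s, g, j + 1))) = 0 := by
    rw [Finset.sum_sub_distrib, sub_eq_zero]
    exact (Equiv.sum_comp (Equiv.addRight 1) fun j => σ (.chain (s, g, j))).symm
  have sum_hub (g : Hub d N) :
      ∑ j, c (s, g, j) = ∑ j, ∑ m, σ (Vertex.links (s, g, j) m) := by
    simp only [← fun j => (solves_iff.1 h (s, g, j)).2, Finset.sum_add_distrib, Vertex.next,
      sum_chain, add_zero]
  simp only [sum_hub]
  cases s
  · simp only [Vertex.links, Fintype.sum_prod_type]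
  · refine Eq.trans ?_ Finset.sum_comm
    simp only [Vertex.links, Fintype.sum_prod_type]

theorem Solves.sum_sign_mul_eq_zero [NeZero N] {σ : Var d N → R} {c : Vertex d N → R}
    (h : Solves σ c) : ∑ v, sign v.1 * c v = 0 := by
  simp [Fintype.sum_prod_type, sign, ← Finset.mul_sum, h.sum_family_eq_sum_link]

/-- The right-hand sides which vanish except at `v`. -/
def charge (v : Vertex d N) : Vertex d N → R := Pi.single v (sign v.1)

theorem sum_sign_mul_charge [NeZero N] (v : Vertex d N) :
    ∑ w, sign w.1 * charge v w = (1 : R) := by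
  obtain ⟨_ | _, g, j⟩ := v <;> simp [charge, sign, Pi.single_apply]

/-- The assignment can be changed outside of `P` in such a way that the error in the equations
moves from `v` to `w`. -/
def CanMove (R : Type) [CommRing R] (P : Set (Var d N)) (v w : Vertex d N) : Prop :=
  ∃ δ : Var d N → R, (∀ x ∈ P, δ x = 0) ∧ Solves δ (charge v - charge w)

variable {P : Set (Var d N)}

theorem CanMove.trans {u v w : Vertex d N} (h : CanMove R P u v) (h' : CanMove R P v w) :
    CanMove R P u w := by
  obtain ⟨δ, hδ, h_solves⟩ := h
  obtain ⟨δ', hδ', h_solves'⟩ := h'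
  refine ⟨δ + δ', fun x hx => ?_, by simpa only [sub_add_sub_cancel] using h_solves.add h_solves'⟩
  rw [Pi.add_apply, hδ x hx, hδ' x hx, add_zero]

theorem CanMove.symm {v w : Vertex d N} (h : CanMove R P v w) : CanMove R P w v := by
  obtain ⟨δ, hδ, h_solves⟩ := h
  refine ⟨-δ, fun x hx => ?_, by simpa only [neg_sub] using h_solves.neg⟩
  rw [Pi.neg_apply, hδ x hx, neg_zero]

instance : Trans (CanMove R P : Vertex d N → Vertex d N → Prop) (CanMove R P) (CanMove R P) :=
  ⟨CanMove.trans⟩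

open Classical in
theorem canMove_link {g h : Hub d N} (hP : .link g h ∉ P) :
    CanMove R P (false, g, h.1) (true, h, g.1) := by
  refine ⟨Pi.single (.link g h) 1, fun x hx => Pi.single_eq_of_ne (ne_of_mem_of_not_mem hx hP) _,
    solves_iff.2 fun u => ⟨by simp, ?_⟩⟩
  obtain ⟨_ | _, k, p⟩ := u
  · simp [Vertex.links, charge, sign, Pi.single_apply, Prod.ext_iff, ite_and]
  · simp [Vertex.links, charge, sign, Pi.single_apply, Prod.ext_iff, ite_and]
    grind

theorem exists_cycle_flow {M : Type*} [AddCommGroup M] [NeZero N] (j j' : ZMod N) (t : M) :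
    ∃ a : ZMod N → M, ∀ p, a p - a (p + 1) = (Pi.single j t - Pi.single j' t : ZMod N → M) p := by
  suffices h : ∀ n : ℕ, ∃ a : ZMod N → M, ∀ p,
      a p - a (p + 1) = (Pi.single j t - Pi.single (j + n) t : ZMod N → M) p by
    simpa using h (j' - j).val
  intro n
  induction n with
  | zero => exact ⟨0, by simp⟩
  | succ n ih =>
    obtain ⟨a, ha⟩ := ih
    refine ⟨a - Pi.single (j + n + 1) t, fun p => ?_⟩
    have h_shift : (Pi.single (j + n + 1) t : ZMod N → M) (p + 1) =
        (Pi.single (j + n) t : ZMod N → M) p := by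
      simp only [Pi.single_apply, add_left_inj]
    have := ha p
    simp only [Pi.sub_apply, h_shift, Nat.cast_succ, ← add_assoc] at this ⊢
    rw [sub_sub_sub_comm, this]
    abel

/-- The variables which occur only in the equations of the given hub. -/
def hubVars (s : Bool) (g : Hub d N) : Set (Var d N) :=
  {x | ∃ p, x = .chain (s, g, p) ∨ x = .slope (s, g, p)}

/-- The assignment which is `a` on the cycle of the given hub, and zero on all links and at all
other hubs. -/
def hubFlow (s : Bool) (g : Hub d N) (a : ZMod N → R) : Var d N → R
  | .link _ _ => 0
  | .chain v => if v.1 = s ∧ v.2.1 = g then a v.2.2 else 0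
  | .slope v => if v.1 = s ∧ v.2.1 = g then -(a v.2.2 + a (v.2.2 + 1)) else 0

theorem solves_hubFlow {s : Bool} {g : Hub d N} {j j' : ZMod N} {a : ZMod N → R}
    (ha : ∀ p, a p - a (p + 1) = (Pi.single j (sign s) - Pi.single j' (sign s) : ZMod N → R) p) :
    Solves (hubFlow s g a) (charge (s, g, j) - charge (s, g, j')) := by
  refine solves_iff.2 fun ⟨s', g', p⟩ => ?_
  have h_links (m) : hubFlow s g a (Vertex.links (s', g', p) m) = 0 := by cases s' <;> rfl
  rw [Finset.sum_eq_zero fun m _ => h_links m, zero_add]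
  simp only [hubFlow, Vertex.next]
  by_cases h : s' = s ∧ g' = g
  · obtain ⟨rfl, rfl⟩ := h
    simp [ha, charge, Pi.single_apply]
  · simp [h, charge, ← and_assoc]

theorem hubFlow_eq_zero {s : Bool} {g : Hub d N} {x : Var d N} (hx : x ∉ hubVars s g)
    (a : ZMod N → R) : hubFlow s g a x = 0 := by
  rcases x with _ | ⟨s', g', p⟩ | ⟨s', g', p⟩
  · rfl
  all_goals
    refine if_neg ?_
    rintro ⟨rfl, rfl⟩
    exact hx ⟨p, by simp⟩

theorem exists_hubFlow_add_const_eq_zero (h2 : IsUnit (2 : R)) (s : Bool) (g : Hub d N)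
    (a : ZMod N → R) (x : Var d N) : ∃ t, hubFlow s g (fun p => a p + t) x = 0 := by
  by_cases hx : x ∈ hubVars s g
  · obtain ⟨p, rfl | rfl⟩ := hx
    · exact ⟨-a p, by simp [hubFlow]⟩
    · obtain ⟨b, hb⟩ := h2.dvd (a := a p + a (p + 1))
      refine ⟨-b, ?_⟩
      simp only [hubFlow, and_self, if_true]
      linear_combination -hb
  · exact ⟨0, hubFlow_eq_zero hx _⟩

/-- A constant may be added to a flow around a hub, so that one of its values can be prescribed. -/
theorem canMove_hub [NeZero N] (h2 : IsUnit (2 : R)) {s : Bool} {g : Hub d N}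
    (hP : (P ∩ hubVars s g).Subsingleton) (j j' : ZMod N) : CanMove R P (s, g, j) (s, g, j') := by
  obtain ⟨a, ha⟩ := exists_cycle_flow j j' (sign s : R)
  have move {t : R} (ht : ∀ x ∈ P ∩ hubVars s g, hubFlow s g (fun p => a p + t) x = 0) :
      CanMove R P (s, g, j) (s, g, j') := by
    refine ⟨hubFlow s g fun p => a p + t, fun x hx => ?_, solves_hubFlow fun p => ?_⟩
    · by_cases hx' : x ∈ hubVars s g
      exacts [ht x ⟨hx, hx'⟩, hubFlow_eq_zero hx' _]
    · rw [add_sub_add_right_eq_sub, ha]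
  rcases hP.eq_empty_or_singleton with h | ⟨x, h⟩
  · exact move (t := 0) (by simp [h])
  · obtain ⟨t, ht⟩ := exists_hubFlow_add_const_eq_zero h2 s g a x
    exact move (t := t) (by simpa [h] using ht)

/-- The hub of the family `s` in whose equations the variable occurs. -/
def Var.hub? (s : Bool) : Var d N → Option (Hub d N)
  | .link g h => some (bif s then h else g)
  | .chain v | .slope v => if v.1 = s then some v.2.1 else none

theorem hub?_eq_of_mem_hubVars {s : Bool} {g : Hub d N} {x : Var d N} (hx : x ∈ hubVars s g)
    (s' : Bool) : x.hub? s' = if s = s' then some g else none := by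
  obtain ⟨p, rfl | rfl⟩ := hx <;> rfl

/-- The variables at the hub `g` of the first family and at the hubs of the other family to which
the vertex `(false, g, j)` is linked. -/
def hubStar (g : Hub d N) (j : ZMod N) : Set (Var d N) :=
  {x | x.hub? false = some g ∨ ∃ m, x.hub? true = some (j, m)}

theorem mem_hubStar_of_mem_hubVars_false {g : Hub d N} {x : Var d N} (hx : x ∈ hubVars false g)
    (j : ZMod N) : x ∈ hubStar g j :=
  .inl (hub?_eq_of_mem_hubVars hx false)

theorem mem_hubStar_of_mem_hubVars_true {j : ZMod N} {m : Fin d} {x : Var d N}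
    (hx : x ∈ hubVars true (j, m)) (g : Hub d N) : x ∈ hubStar g j :=
  .inr ⟨m, hub?_eq_of_mem_hubVars hx true⟩

theorem link_mem_hubStar_left (g h : Hub d N) (j : ZMod N) : .link g h ∈ hubStar g j := .inl rfl

theorem link_mem_hubStar_right (g g' : Hub d N) (j : ZMod N) (m : Fin d) :
    .link g' (j, m) ∈ hubStar g j :=
  .inr ⟨m, rfl⟩

theorem subsingleton_or_exists_link_notMem [NeZero N] {g : Hub d N} {j : ZMod N}
    (hP : (P ∩ hubStar g j).ncard ≤ d + 1) : (P ∩ hubVars false g).Subsingleton ∨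
      ∃ m, .link g (j, m) ∉ P ∧ P ∩ hubVars true (j, m) = ∅ := by
  by_contra! h
  obtain ⟨h_nontrivial, h_occupied⟩ := h
  have exists_mem (m) : ∃ x ∈ P, x ∉ hubVars false g ∧ x.hub? true = some (j, m) := by
    by_cases hm : .link g (j, m) ∈ P
    · exact ⟨_, hm, by simp [hubVars], rfl⟩
    · obtain ⟨x, hx, hx'⟩ := h_occupied m hm
      have h_hub := hub?_eq_of_mem_hubVars hx' true
      refine ⟨x, hx, fun h => ?_, h_hub⟩
      simpa [h_hub] using hub?_eq_of_mem_hubVars h true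
  choose x hxP hx_false hx_true using exists_mem
  have hx_inj : Function.Injective x := fun m m' h =>
    congrArg Prod.snd (Option.some.inj ((hx_true m).symm.trans (h ▸ hx_true m')))
  have h_disjoint : Disjoint (P ∩ hubVars false g) (Set.range x) := by
    refine Set.disjoint_right.2 ?_
    rintro _ ⟨m, rfl⟩ h
    exact hx_false m h.2
  have h_subset : P ∩ hubVars false g ∪ Set.range x ⊆ P ∩ hubStar g j := by
    rintro y (hy | ⟨m, rfl⟩)
    exacts [⟨hy.1, mem_hubStar_of_mem_hubVars_false hy.2 j⟩, ⟨hxP m, .inr ⟨m, hx_true m⟩⟩]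
  have h_card := Set.ncard_le_ncard h_subset
  have h_range : (Set.range x).ncard = d := by
    rw [← Nat.card_coe_set_eq, Nat.card_range_of_injective hx_inj, Nat.card_fin]
  rw [Set.ncard_union_eq h_disjoint, h_range] at h_card
  have := Set.one_lt_ncard_iff_nontrivial.2 h_nontrivial
  omega

theorem exists_scope_notMem [NeZero N] {g : Hub d N} {j : ZMod N}
    (hP : (P ∩ hubStar g j).ncard ≤ d + 1) : ∃ i, Vertex.scope (false, g, j) i ∉ P := by
  by_contra! h
  rcases subsingleton_or_exists_link_notMem hP with h_hub | ⟨m, hm, -⟩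
  · have := h_hub ⟨h 0, j, .inr rfl⟩ ⟨h 1, j, .inl rfl⟩
    simp [Vertex.scope] at this
  · exact hm (h m.succ.succ.succ)

theorem exists_block_disjoint [NeZero N] (hP : P.ncard < N) (s : Bool) :
    ∃ i, ∀ x ∈ P, ∀ m, x.hub? s ≠ some (i, m) := by
  by_contra! h
  choose x hxP m hx using h
  have hx_inj : Function.Injective x := fun i i' h =>
    congrArg Prod.fst (Option.some.inj ((hx i).symm.trans (h ▸ hx i')))
  have h_card := Set.ncard_le_ncard (Set.range_subset_iff.2 hxP)
  rw [← Nat.card_coe_set_eq, Nat.card_range_of_injective hx_inj, Nat.card_zmod] at h_card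
  omega

theorem exists_inter_hubStar_eq_empty [NeZero N] [NeZero d] (hP : P.ncard < N) :
    ∃ g j, P ∩ hubStar g j = ∅ := by
  obtain ⟨i, hi⟩ := exists_block_disjoint hP false
  obtain ⟨j, hj⟩ := exists_block_disjoint hP true
  refine ⟨(i, 0), j, Set.eq_empty_iff_forall_notMem.2 ?_⟩
  rintro x ⟨hx, h | ⟨m, h⟩⟩
  exacts [hi x hx 0 h, hj x hx m h]

theorem canMove_of_inter_hubStar_eq_empty [NeZero N] [NeZero d] (h2 : IsUnit (2 : R))
    {g g' : Hub d N} {j j' : ZMod N} (hP : (P ∩ hubStar g j).ncard ≤ d + 1)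
    (hP' : P ∩ hubStar g' j' = ∅) : CanMove R P (false, g, j) (false, g', j') := by
  have notMem {x} (hx : x ∈ hubStar g' j') : x ∉ P := fun hxP => hP'.subset ⟨hxP, hx⟩
  rcases subsingleton_or_exists_link_notMem hP with h_hub | ⟨m, hm, h_empty⟩
  · have h_sub : (P ∩ hubVars true (j', 0)).Subsingleton := fun x hx =>
      (notMem (mem_hubStar_of_mem_hubVars_true hx.2 g') hx.1).elim
    calc
      CanMove R P (false, g, j) (false, g, j') := canMove_hub h2 h_hub j j'
      CanMove R P _ (true, (j', 0), g.1) :=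
        canMove_link (notMem (link_mem_hubStar_right g' g j' 0))
      CanMove R P _ (true, (j', 0), g'.1) := canMove_hub h2 h_sub g.1 g'.1
      CanMove R P _ (false, g', j') :=
        (canMove_link (notMem (link_mem_hubStar_left g' (j', 0) j'))).symm
  · have h_sub : (P ∩ hubVars false g').Subsingleton := fun x hx =>
      (notMem (mem_hubStar_of_mem_hubVars_false hx.2 j') hx.1).elim
    calc
      CanMove R P (false, g, j) (true, (j, m), g.1) := canMove_link hm
      CanMove R P _ (true, (j, m), g'.1) :=
        canMove_hub h2 (h_empty ▸ Set.subsingleton_empty) g.1 g'.1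
      CanMove R P _ (false, g', j) :=
        (canMove_link (notMem (link_mem_hubStar_left g' (j, m) j'))).symm
      CanMove R P _ (false, g', j') := canMove_hub h2 h_sub j j'

end System

/-! ### The lifted systems -/

section Lift

variable {R : Type} [CommRing R] {d N : ℕ}

/-- The system with the right-hand sides `c` as a structure: the copies of a variable, one for each
element of `R`, are the values which it may be shifted by. -/
@[reducible] def liftStructure [Finite R] (c : Vertex d N → R) :
    (templateVoc R d).Structure (Var d N × R) :=
  structureOfRel finRelational_templateVoc fun _ S => match S with
    | .lin => fun a => ∃ v : Vertex d N, (∀ i, (a i).1 = v.scope i) ∧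
        (fun i => (a i).2) ∈ linRel d (c v)
    | .translate t => fun a => ∀ i : Fin (d + 2), a i.succ = ((a 0).1, (a 0).2 + t)

/-- The system with the right-hand sides `c` as a finite structure. -/
@[reducible] def lift [Finite R] [NeZero N] [NeZero d] (c : Vertex d N → R) :
    FinStr (templateVoc R d) :=
  FinStr.of (Var d N × R) (liftStructure c)

theorem exists_solves_of_lift_mapsTo_template [Finite R] [NeZero N] [NeZero d]
    {c : Vertex d N → R} (h : (lift c).MapsTo (template R d)) : ∃ σ : Var d N → R, Solves σ c := by
  obtain ⟨f⟩ := h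
  let F : Var d N × R → R := f
  have F_eq (x : Var d N) (t : R) : F (x, t) = F (x, 0) + t :=
    f.map_rel' (TemplateRel.translate t : TemplateRel R d (d + 3))
      (Fin.cons (x, 0) fun _ => (x, t) : Fin (d + 3) → Var d N × R)
      (fun _ => by rw [Fin.cons_succ, Fin.cons_zero, zero_add]) 0
  refine ⟨fun x => -F (x, 0), fun v => ?_⟩
  obtain ⟨y, hy⟩ := exists_mem_linRel d (c v)
  have hF : (fun i => F (v.scope i, y i)) ∈ linRel (R := R) d 0 :=
    f.map_rel' (TemplateRel.lin : TemplateRel R d (d + 3)) (fun i => (v.scope i, y i))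
      ⟨v, fun _ => rfl, hy⟩
  have y_eq : (fun x => -F (x, 0)) ∘ v.scope + (fun i => F (v.scope i, y i)) = y := by
    funext i
    simp only [Pi.add_apply, Function.comp_apply, F_eq _ (y i), neg_add_cancel_left]
  refine (add_mem_linRel_iff hF).1 ?_
  rwa [y_eq, add_zero]

theorem lift_mapsTo_template_of_solves [Finite R] [NeZero N] [NeZero d]
    {c : Vertex d N → R} {σ : Var d N → R} (hσ : Solves σ c) : (lift c).MapsTo (template R d) := by
  let F : Var d N × R → R := fun a => a.2 - σ a.1
  have map_lin (a : Fin (d + 3) → Var d N × R) (v : Vertex d N)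
      (hv : ∀ i, (a i).1 = v.scope i) (ha : (fun i => (a i).2) ∈ linRel d (c v)) :
      F ∘ a ∈ linRel d 0 := by
    have a_eq : F ∘ a + σ ∘ v.scope = fun i => (a i).2 := by
      funext i
      simp only [Pi.add_apply, Function.comp_apply, F, hv, sub_add_cancel]
    refine (add_mem_linRel_iff (hσ v)).1 ?_
    rwa [a_eq, zero_add]
  have map_translate (a : Fin (d + 3) → Var d N × R) (t : R)
      (ha : ∀ i : Fin (d + 2), a i.succ = ((a 0).1, (a 0).2 + t)) : F ∘ a ∈ translateRel d t :=
    fun i => by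
      simp only [Function.comp_apply, ha i, F]
      ring
  refine ⟨⟨F, fun g => g.elim, ?_⟩⟩
  rintro _ (_ | t) a ha
  · obtain ⟨v, hv, h⟩ := ha
    exact map_lin a v hv h
  · exact map_translate a t ha

theorem lift_zero_mapsTo_template [Finite R] [NeZero N] [NeZero d] :
    (lift (0 : Vertex d N → R)).MapsTo (template R d) :=
  lift_mapsTo_template_of_solves solves_zero

theorem not_lift_charge_mapsTo_template [Finite R] [Nontrivial R] [NeZero N] [NeZero d]
    (v : Vertex d N) : ¬ (lift (charge v : Vertex d N → R)).MapsTo (template R d) := fun h => by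
  obtain ⟨σ, hσ⟩ := exists_solves_of_lift_mapsTo_template h
  exact one_ne_zero ((sum_sign_mul_charge v).symm.trans hσ.sum_sign_mul_eq_zero)

/-- The bijection which adds `σ x` to the copies of the variable `x`. -/
def shift (σ : Var d N → R) : Var d N × R ≃ Var d N × R :=
  Equiv.prodShear (Equiv.refl _) fun x => Equiv.addRight (σ x)

open FirstOrder.Language.Structure in
theorem relMap_shift_iff [Finite R] {c δ : Vertex d N → R} {σ : Var d N → R} {n : ℕ}
    (S : (templateVoc R d).Relations n) (a : Fin n → Var d N × R)
    (h : ∀ v : Vertex d N, (∀ i, v.scope i ∈ Set.range (Prod.fst ∘ a)) →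
      σ ∘ v.scope ∈ linRel d (δ v)) :
    @RelMap _ _ (liftStructure c) n S a ↔
      @RelMap _ _ (liftStructure (c + δ)) n S (shift σ ∘ a) := by
  obtain _ | t := S
  · refine exists_congr fun v => and_congr_right fun hv => ?_
    have shift_eq : (fun i => (a i).2) + σ ∘ v.scope = fun i => (shift σ (a i)).2 := by
      funext i
      simp [shift, hv]
    rw [← add_mem_linRel_iff (h v fun i => ⟨i, hv i⟩), shift_eq]
    rfl
  · refine forall_congr' fun i => ?_
    rw [← (shift σ).injective.eq_iff]
    simp [shift, add_right_comm]

/-- The invariant of Duplicator's strategy, when the elements of `X` are pebbled and the position is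
given by the bijection `f`: the equations fail at most at a vertex with few pebbles around it. -/
def StrategyInvariant (v : Vertex d N) (X : Set (Var d N × R))
    (f : Var d N × R ≃ Var d N × R) : Prop :=
  ∃ g j, ∃ σ : Var d N → R, f = shift σ ∧ Solves σ (charge v - charge (false, g, j)) ∧
    (Prod.fst '' X ∩ hubStar g j).ncard ≤ d + 1

open FirstOrder.Language.Structure in
theorem StrategyInvariant.relMap_iff [Finite R] [NeZero N] {v : Vertex d N} {X : Set (Var d N × R)}
    {f : Var d N × R ≃ Var d N × R} (hf : StrategyInvariant v X f) (c : Vertex d N → R) {n : ℕ}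
    (S : (templateVoc R d).Relations n) (a : Fin n → Var d N × R) (ha : ∀ i, a i ∈ X) :
    @RelMap _ _ (liftStructure c) n S a ↔
      @RelMap _ _ (liftStructure (c + charge v)) n S (f ∘ a) := by
  obtain ⟨g, j, σ, rfl, hσ, h_card⟩ := hf
  refine relMap_shift_iff S a fun w hw => ?_
  have h_ne : w ≠ (false, g, j) := by
    rintro rfl
    obtain ⟨i, hi⟩ := exists_scope_notMem h_card
    obtain ⟨l, hl⟩ := hw i
    exact hi (hl ▸ Set.mem_image_of_mem _ (ha l))
  have h_charge : charge (false, g, j) w = (0 : R) := Pi.single_eq_of_ne h_ne _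
  simpa [h_charge] using hσ w

theorem StrategyInvariant.exists_step [Finite R] [NeZero N] [NeZero d]
    (h2 : IsUnit (2 : R)) {v : Vertex d N} {X : Set (Var d N × R)} {f : Var d N × R ≃ Var d N × R}
    (hf : StrategyInvariant v X f) (hX : X.ncard < N) :
    ∃ f' : Var d N × R ≃ Var d N × R, Set.EqOn f f' X ∧
      ∀ e : Fin (d + 1) → Var d N × R, ∀ Y ⊆ X ∪ Set.range e, StrategyInvariant v Y f' := by
  obtain ⟨g, j, σ, rfl, hσ, h_card⟩ := hf
  obtain ⟨g', j', h_free⟩ :=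
    exists_inter_hubStar_eq_empty ((Set.ncard_image_le (f := Prod.fst) X.toFinite).trans_lt hX)
  obtain ⟨δ, hδ, h_solves⟩ := canMove_of_inter_hubStar_eq_empty h2 h_card h_free
  refine ⟨shift (σ + δ), fun a ha => ?_, fun e Y hY => ⟨g', j', σ + δ, rfl, ?_, ?_⟩⟩
  · simp [shift, hδ a.1 (Set.mem_image_of_mem _ ha)]
  · simpa only [sub_add_sub_cancel] using hσ.add h_solves
  · have h_subset : Prod.fst '' Y ∩ hubStar g' j' ⊆ Set.range (Prod.fst ∘ e) := by
      rintro _ ⟨⟨a, ha, rfl⟩, h_star⟩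
      rcases hY ha with haX | ⟨i, rfl⟩
      · exact (h_free.subset ⟨Set.mem_image_of_mem _ haX, h_star⟩).elim
      · exact ⟨i, rfl⟩
    exact (Set.ncard_le_ncard h_subset).trans (ncard_range_fin_le _)

theorem strategyInvariant_empty (g : Hub d N) (j : ZMod N) :
    StrategyInvariant (R := R) (false, g, j) ∅ (shift 0) :=
  ⟨g, j, 0, rfl, by simpa using solves_zero, by simp⟩

theorem duplicatorWins_lift [Finite R] [NeZero N] [NeZero d] (h2 : IsUnit (2 : R)) {k : ℕ}
    (hk : k < N) (c : Vertex d N → R) (g : Hub d N) (j : ZMod N) :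
    DuplicatorWins k (d + 1) (lift c) (lift (c + charge (false, g, j))) := by
  refine duplicatorWins_of_bijections (A := lift c) (B := lift (c + charge (false, g, j)))
    (StrategyInvariant (false, g, j))
    ⟨shift 0, strategyInvariant_empty g j⟩
    (fun X f hf n S a ha => hf.relMap_iff c S a ha)
    fun X f hf hX => hf.exists_step h2 (hX.trans_lt hk)

end Lift

/-! ### The theorem -/

theorem exists_duplicatorWins_template {R : Type} [CommRing R] [Finite R] [Nontrivial R]
    (h2 : IsUnit (2 : R)) (d : ℕ) [NeZero d] (k : ℕ) : ∃ A A' : FinStr (templateVoc R d),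
      A.MapsTo (template R d) ∧ ¬ A'.MapsTo (template R d) ∧ DuplicatorWins k (d + 1) A A' := by
  let g : Hub d (k + 1) := (0, 0)
  refine ⟨lift (0 : Vertex d (k + 1) → R), lift (charge (false, g, 0)), lift_zero_mapsTo_template,
    not_lift_charge_mapsTo_template _, ?_⟩
  simpa only [zero_add] using
    duplicatorWins_lift h2 k.lt_succ_self (0 : Vertex d (k + 1) → R) g 0

theorem mainTheorem2_general (R : Type) [CommRing R] [Finite R] [Nontrivial R]
    (h2 : IsUnit (2 : R)) (ℓ : ℕ) (hℓ : 3 ≤ ℓ) :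
    ¬ LogicLE (nearUnanimityCSPQuantifiers ℓ (ℓ + 1)) (quantifiersOfArity (ℓ - 1)) ∧
    ∃ (τ : FirstOrder.Language.{0, 0}) (hτ : FinRelational τ) (S : τ.Structure R),
      (∀ n, Nonempty (τ.Relations n) → n = ℓ + 1) ∧
      IsPartialPolymorphism τ (nearUnanimity ℓ R) ∧
      cspQuantifier hτ (FinStr.of R S) ∈ nearUnanimityCSPQuantifiers ℓ (ℓ + 1) ∧
      ¬ DefinableIn (quantifiersOfArity (ℓ - 1)) {A : FinStr τ | A.MapsTo (FinStr.of R S)} ∧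
      ∀ k : ℕ, ∃ A A' : FinStr τ, A.MapsTo (FinStr.of R S) ∧ ¬ A'.MapsTo (FinStr.of R S) ∧
        DuplicatorWins k (ℓ - 1) A A' := by
  obtain ⟨d, rfl⟩ : ∃ d, ℓ = d + 2 := ⟨ℓ - 2, by omega⟩
  have hd : 1 ≤ d := by omega
  have : NeZero d := ⟨by omega⟩
  have h_poly := isPartialPolymorphism_template h2 hd
  have h_mem : cspQuantifier finRelational_templateVoc (template R d) ∈
      nearUnanimityCSPQuantifiers (d + 2) (d + 3) :=
    cspQuantifier_mem_nearUnanimityCSPQuantifiers hℓ finRelational_templateVoc h_poly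
      fun n h => (eq_of_nonempty_templateVoc_relations h).le
  have h_game := exists_duplicatorWins_template h2 d
  have h_undefinable : ¬ DefinableIn (quantifiersOfArity (d + 1))
      {A | A.MapsTo (template R d)} :=
    not_definableIn_of_duplicatorWins (by omega) subset_rfl fun k _ => h_game k
  exact ⟨not_logicLE_of_not_definableIn h_mem h_undefinable, templateVoc R d,
    finRelational_templateVoc, templateStructure R d,
    fun n h => eq_of_nonempty_templateVoc_relations h, h_poly, h_mem, h_undefinable, h_game⟩

theorem mainTheorem2 (ℓ : ℕ) (hℓ : 3 ≤ ℓ) :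
    ¬ LogicLE (nearUnanimityCSPQuantifiers ℓ (ℓ + 1)) (quantifiersOfArity (ℓ - 1)) ∧
    ∃ (τ : FirstOrder.Language.{0, 0}) (hτ : FinRelational τ) (S : τ.Structure (ZMod 3)),
      (∀ n, Nonempty (τ.Relations n) → n = ℓ + 1) ∧
      IsPartialPolymorphism τ (nearUnanimity ℓ (ZMod 3)) ∧
      cspQuantifier hτ (FinStr.of (ZMod 3) S) ∈ nearUnanimityCSPQuantifiers ℓ (ℓ + 1) ∧
      ¬ DefinableIn (quantifiersOfArity (ℓ - 1))
          {A : FinStr τ | A.MapsTo (FinStr.of (ZMod 3) S)} ∧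
      ∀ k : ℕ, ℓ - 1 ≤ k → ∃ A A' : FinStr τ,
        A.MapsTo (FinStr.of (ZMod 3) S) ∧ ¬ A'.MapsTo (FinStr.of (ZMod 3) S) ∧
          DuplicatorWins k (ℓ - 1) A A' := by
  obtain ⟨h, τ, hτ, S, h_arity, h_poly, h_mem, h_undef, h_game⟩ :=
    mainTheorem2_general (ZMod 3) (.of_mul_eq_one 2 rfl) ℓ hℓ
  exact ⟨h, τ, hτ, S, h_arity, h_poly, h_mem, h_undef, fun k _ => h_game k⟩
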